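/- **Setting.** Agents $i\in\mathcal M=\{1,\dots,m\}$ have convex objective functions $f_i:\mathbb R^n\to\mathbb R$ and constraint sets $X_i\subseteq\mathbb R^n$; $\|\cdot\|$ is the Euclidean norm and $P_{X}$ the Euclidean projection on a nonempty closed convex set $X$. Let $n(0),n(1),\dots$ be independent random elements of a measurable space $\Omega'$, defined on a probability space $(\Omega,\mathcal F,P)$, let $\psi:\mathbb R^{n\times m}\times\Omega'\to\mathbb R^{m\times m}$ be measurable, and let $\alpha(k)>0$ be stepsizes. The projected multi-agent subgradient algorithm starts at deterministic $x_i(0)\in X_i$ and, with $x(k)=(x_i(k))_{i\in\mathcal M}$, generates for all $k\ge0$ $$A(k)=[a_{ij}(k)]=\psi(x(k),n(k)),\qquad v_i(k)=\sum_{j=1}^m a_{ij}(k)x_j(k),\qquad x_i(k+1)=P_{X_i}\big[v_i(k)-\alpha(k)d_i(k)\big],$$ where $d_i(k)$ is a subgradient of $f_i$ at $v_i(k)$, selected as a measurable function of $n(0),\dots,n(k)$. Let $(\mathcal M,\mathcal E)$ be a directed graph and let $\gamma,K,C>0$ and $\delta\in(0,1]$ be constants such that for all $(j,i)\in\mathcal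 E$ and all $k\ge 0$ $$P\big(a_{ij}(k)\ge\gamma\,\big|\,x(k)=\overline x\big)\ \ge\ \min\Big\{\delta,\frac{K}{\|\overline x_i-\overline x_j\|^{C}}\Big\}\qquad\text{for almost every }\overline x\text{ with respect to the law of }x(k),$$ where the right-hand side is read as $\delta$ if $\overline x_i=\overline x_j$. **Assumptions.** 1. (Bounded subgradients) There is $L>0$ such that $\|s\|\le L$ for all $i\in\mathcal M$, $x\in\mathbb R^n$ and $s\in\partial f_i(x)$. 2. (Connectivity) $(\mathcal M,\mathcal E)$ is strongly connected. 3. (Doubly stochastic weights) For every $k\ge0$, $A(k)$ is doubly stochastic with probability one. 4. (Self confidence) $a_{ii}(k)\ge\gamma$ for all $i\in\mathcal M$ and $k\ge0$ with probability one. 5. (Identical constraint sets) $X_i=X$ for all $i$, for one closed convex set $X$. 6. (Limiting stepsizes) $\lim_{k\to\infty}k\,\log^p(k)\,\alpha(k)=0$ for every real $p<1$. **Proposition.** Under these assumptions, with $y(k)=\frac1m\sum_{j=1}^m x_j(k)$, for every agent $i$: (a) $\sum_{k=0}^\infty\alpha(k)\|x_i(k)-y(k)\|<\infty$ with probability one;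 (b) $\lim_{k\to\infty}\|x_i(k)-y(k)\|=0$ with probability one. -/

import Mathlib

open Set Filter Topology MeasureTheory ProbabilityTheory

/-- The state of the network: one estimate in `ℝⁿ` (Euclidean norm) for each of the `m` agents. -/
abbrev NetState (m n : ℕ) : Type := Fin m → EuclideanSpace ℝ (Fin n)

/-- The set of subgradients at `x` of a finite function `F` on `ℝⁿ`. -/
def subgradients {n : ℕ} (F : EuclideanSpace ℝ (Fin n) → ℝ) (x : EuclideanSpace ℝ (Fin n)) :
    Set (EuclideanSpace ℝ (Fin n)) :=
  {s | ∀ z, F x + inner ℝ s (z - x) ≤ F z}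

open Classical in
/-- The Euclidean projection of `u` on `X`: a point of `X` at minimal distance from `u`
(with value `u` if there is none). It is used for nonempty closed convex `X` only, where
the minimizer exists and is unique, see `euclProj_eq_iff`. -/
noncomputable def euclProj {n : ℕ} (X : Set (EuclideanSpace ℝ (Fin n)))
    (u : EuclideanSpace ℝ (Fin n)) : EuclideanSpace ℝ (Fin n) :=
  if h : ∃ p ∈ X, ∀ z ∈ X, ‖u - p‖ ≤ ‖u - z‖ then h.choose else u

theorem euclProj_spec {n : ℕ} {X : Set (EuclideanSpace ℝ (Fin n))} (hc : IsClosed X)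
    (hne : X.Nonempty) (u : EuclideanSpace ℝ (Fin n)) :
    euclProj X u ∈ X ∧ ∀ z ∈ X, ‖u - euclProj X u‖ ≤ ‖u - z‖ := by
  have h : ∃ p ∈ X, ∀ z ∈ X, ‖u - p‖ ≤ ‖u - z‖ := by
    obtain ⟨p, hp, hd⟩ := hc.exists_infDist_eq_dist hne u
    refine ⟨p, hp, fun z hz => ?_⟩
    rw [← dist_eq_norm, ← dist_eq_norm, ← hd]
    exact Metric.infDist_le_dist_of_mem hz
  unfold euclProj
  rw [dif_pos h]
  exact h.choose_spec

theorem euclProj_eq_iff {n : ℕ} {X : Set (EuclideanSpace ℝ (Fin n))} (hc : IsClosed X)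
    (hv : Convex ℝ X) (hne : X.Nonempty) (u p : EuclideanSpace ℝ (Fin n)) :
    euclProj X u = p ↔ p ∈ X ∧ ∀ z ∈ X, ‖u - p‖ ≤ ‖u - z‖ := by
  have key : ∀ q ∈ X, (∀ z ∈ X, ‖u - q‖ ≤ ‖u - z‖) → ∀ z ∈ X, inner ℝ (u - q) (z - q) ≤ 0 := by
    intro q hq hmin
    refine (norm_eq_iInf_iff_real_inner_le_zero hv hq).1 (le_antisymm ?_ ?_)
    · have : Nonempty X := hne.to_subtype
      exact le_ciInf fun z => hmin z z.2
    · exact ciInf_le ⟨0, by rintro _ ⟨z, rfl⟩; exact norm_nonneg _⟩ (⟨q, hq⟩ : X)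
  obtain ⟨hs, hmin⟩ := euclProj_spec hc hne u
  constructor
  · rintro rfl
    exact ⟨hs, hmin⟩
  · rintro ⟨hp, hpm⟩
    have h1 := key _ hs hmin p hp
    have h2 := key _ hp hpm _ hs
    rw [← sub_eq_zero, ← norm_eq_zero, ← sq_eq_zero_iff, ← real_inner_self_eq_norm_sq]
    set q := euclProj X u
    have e : inner ℝ (q - p) (q - p) = inner ℝ (u - q) (p - q) + inner ℝ (u - p) (q - p) := by
      rw [← neg_sub q p, inner_neg_right, neg_add_eq_sub, ← inner_sub_left]
      congr 1
      abel
    have := real_inner_self_nonneg (x := q - p)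
    linarith

/-- The convex combination `v_i = ∑_j a_ij x_j` that agent `i` forms of the estimates. -/
noncomputable def mixedEstimate {m n : ℕ} (a : Matrix (Fin m) (Fin m) ℝ) (x : NetState m n)
    (i : Fin m) : EuclideanSpace ℝ (Fin n) :=
  ∑ j, a i j • x j

/-- The average `(1/m) ∑_j x_j` of the agents' estimates. -/
noncomputable def averageEstimate {m n : ℕ} (x : NetState m n) : EuclideanSpace ℝ (Fin n) :=
  (1 / (m : ℝ)) • ∑ j, x j

/-- The information generated by the noise variables of the times `0, …, k`. -/
abbrev noiseHistory {Ω Ω' : Type*} [MeasurableSpace Ω'] (ξ : ℕ → Ω → Ω') (k : ℕ) :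
    MeasurableSpace Ω :=
  ⨆ j ≤ k, MeasurableSpace.comap (ξ j) inferInstance

/-- `x` (estimates), `A` (communication matrices) and `d` (subgradients) are generated by the
projected multi-agent subgradient algorithm with objective functions `f i`, constraint sets
`X i`, stepsizes `α k`, initial estimates `x₀`, and communication matrices
`A(k) = ψ (x(k), ξ(k))` driven by the noise `ξ`. Any selection of subgradients is allowed
that does not look into the future of the noise. -/
structure IsProjectedSubgradientMethod {m n : ℕ} {Ω Ω' : Type*} [MeasurableSpace Ω']
    (f : Fin m → EuclideanSpace ℝ (Fin n) → ℝ)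
    (X : Fin m → Set (EuclideanSpace ℝ (Fin n)))
    (α : ℕ → ℝ)
    (ψ : NetState m n → Ω' → Matrix (Fin m) (Fin m) ℝ)
    (ξ : ℕ → Ω → Ω')
    (x₀ : NetState m n)
    (x : ℕ → Ω → NetState m n)
    (A : ℕ → Ω → Matrix (Fin m) (Fin m) ℝ)
    (d : ℕ → Ω → NetState m n) : Prop where
  init_mem : ∀ i, x₀ i ∈ X i
  init_eq : ∀ ω, x 0 ω = x₀
  comm_eq : ∀ k ω, A k ω = ψ (x k ω) (ξ k ω)
  subgrad : ∀ k ω i, d k ω i ∈ subgradients (f i) (mixedEstimate (A k ω) (x k ω) i)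
  nonanticipating : ∀ k, Measurable[noiseHistory ξ k] (d k)
  update : ∀ k ω i,
    x (k + 1) ω i = euclProj (X i) (mixedEstimate (A k ω) (x k ω) i - α k • d k ω i)

/-- Bounded subgradients: one `L > 0` bounds all subgradients of all the `f i`. -/
def BoundedSubgradients {m n : ℕ} (f : Fin m → EuclideanSpace ℝ (Fin n) → ℝ) : Prop :=
  ∃ L : ℝ, 0 < L ∧ ∀ i x, ∀ s ∈ subgradients (f i) x, ‖s‖ ≤ L

/-- Strong connectivity: a directed path leads from every agent to every agent. -/
def StronglyConnectedDigraph {V : Type*} (G : Digraph V) : Prop :=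
  ∀ u v, Relation.ReflTransGen G.Adj u v

/-- The number `min {δ, K / r ^ C}`, where `K / 0 ^ C` is read as `+∞`. -/
noncomputable def commLowerBound (δ K C r : ℝ) : ℝ :=
  if r = 0 then δ else min δ (K / r ^ C)

/-- For every edge `(j, i)` of the graph and every time `k`, the conditional probability given
the state `x(k)` that `a_ij(k) ≥ γ` is at least `min {δ, K / ‖x_i(k) - x_j(k)‖ ^ C}`. -/
def DistanceDependentCommunication {m n : ℕ} {Ω : Type*} [MeasurableSpace Ω] (P : Measure Ω)
    (G : Digraph (Fin m)) (γ δ K C : ℝ)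
    (x : ℕ → Ω → NetState m n) (A : ℕ → Ω → Matrix (Fin m) (Fin m) ℝ) : Prop :=
  ∀ i j, G.Adj j i → ∀ k, ∀ᵐ ω ∂P,
    commLowerBound δ K C ‖x k ω i - x k ω j‖ ≤
      (P⟦{ω' | γ ≤ A k ω' i j} | MeasurableSpace.comap (x k) inferInstance⟧) ω

/-- The communication matrices are doubly stochastic with probability one. -/
def DoublyStochasticWeights {m : ℕ} {Ω : Type*} [MeasurableSpace Ω] (P : Measure Ω)
    (A : ℕ → Ω → Matrix (Fin m) (Fin m) ℝ) : Prop :=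
  ∀ k, ∀ᵐ ω ∂P, A k ω ∈ doublyStochastic ℝ (Fin m)

/-- Every agent gives weight at least `γ` to its own estimate, with probability one. -/
def SelfConfidence {m : ℕ} {Ω : Type*} [MeasurableSpace Ω] (P : Measure Ω) (γ : ℝ)
    (A : ℕ → Ω → Matrix (Fin m) (Fin m) ℝ) : Prop :=
  ∀ k i, ∀ᵐ ω ∂P, γ ≤ A k ω i i

/-- All agents have the same closed convex constraint set. -/
def IdenticalConstraintSets {m n : ℕ} (X : Fin m → Set (EuclideanSpace ℝ (Fin n))) : Prop :=
  ∃ Y : Set (EuclideanSpace ℝ (Fin n)), IsClosed Y ∧ Convex ℝ Y ∧ ∀ i, X i = Y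

/-- Limiting stepsizes: `k (log k)^p α(k) → 0` for every real `p < 1`. -/
def LimitingStepsizes (α : ℕ → ℝ) : Prop :=
  ∀ p : ℝ, p < 1 → Tendsto (fun k : ℕ => (k : ℝ) * Real.log k ^ p * α k) atTop (𝓝 0)

/-!
Let `V k` be the sum over the agents of `‖x i k - y k‖ ^ 2`. Averaging with doubly stochastic
weights never increases it, and a link from `j` to `i` that is active (weight at least `γ`, as on
the diagonal) lowers it by at least `γ / 2 * ‖x i k - x j k‖ ^ 2`. The projected subgradient steps
are errors of norm `O(1 / k)`, so the estimates stay in balls of radius `O(log k)`, and each link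
is active with conditional probability at least `q / √k`, because `log k ^ C = O(√k)`. Along a
connected graph this yields `E[V (k + 1)] ≤ (1 - τ / √k) E[V k] + O(k ^ (-3/2))`, the error being
the square of the perturbation divided by the contraction rate. Hence `∑ V k / √k` converges almost
surely. Summability of `α k * ‖x i k - y k‖` follows from
`α k * ‖x i k - y k‖ ≤ α k ^ 2 * √k + V k / √k`. Finally `V k` converges, as its increments are
bounded above by a summable sequence, and its limit is `0` since `∑ 1 / √k` diverges.
-/

section WeightedAverages

variable {ι E : Type*} [Fintype ι] [NormedAddCommGroup E] [InnerProductSpace ℝ E]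
  {a : ι → ℝ} (u : ι → E) (z : E)

theorem sum_mul_norm_sub_sq_eq_add_norm_sum_smul_sub_sq (ha : ∑ j, a j = 1) :
    ∑ j, a j * ‖u j - z‖ ^ 2 =
      ∑ j, a j * ‖u j - ∑ l, a l • u l‖ ^ 2 + ‖(∑ l, a l • u l) - z‖ ^ 2 := by
  set v := ∑ l, a l • u l with hv
  have cross_eq_zero : ∑ j, a j * inner ℝ (u j - v) (v - z) = 0 := by
    have : ∑ j, a j • (u j - v) = 0 := by
      simp only [smul_sub, Finset.sum_sub_distrib, ← Finset.sum_smul, ha, one_smul, ← hv, sub_self]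
    simp only [← real_inner_smul_left, ← sum_inner, this, inner_zero_left]
  have expand : ∀ j, a j * ‖u j - z‖ ^ 2 =
      a j * ‖u j - v‖ ^ 2 + 2 * (a j * inner ℝ (u j - v) (v - z)) + a j * ‖v - z‖ ^ 2 := by
    intro j
    rw [← sub_add_sub_cancel (u j) v z, norm_add_sq_real]
    ring
  simp only [expand, Finset.sum_add_distrib, ← Finset.mul_sum, cross_eq_zero, ← Finset.sum_mul, ha]
  ring

theorem norm_sum_smul_sub_sq_le (ha0 : ∀ j, 0 ≤ a j) (ha : ∑ j, a j = 1) :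
    ‖(∑ l, a l • u l) - z‖ ^ 2 ≤ ∑ j, a j * ‖u j - z‖ ^ 2 := by
  rw [sum_mul_norm_sub_sq_eq_add_norm_sum_smul_sub_sq u z ha]
  exact le_add_of_nonneg_left (Finset.sum_nonneg fun j _ => mul_nonneg (ha0 j) (sq_nonneg _))

theorem norm_sub_sq_le_two_mul_add (p q v : E) :
    ‖p - q‖ ^ 2 ≤ 2 * (‖p - v‖ ^ 2 + ‖q - v‖ ^ 2) := by
  have h := parallelogram_law_with_norm ℝ (p - v) (q - v)
  rw [sub_sub_sub_cancel_right] at h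
  nlinarith [norm_nonneg (p - v + (q - v))]

theorem norm_sum_smul_sub_sq_add_le (ha0 : ∀ j, 0 ≤ a j) (ha : ∑ j, a j = 1) {γ : ℝ} (hγ : 0 ≤ γ)
    {i j : ι} (hi : γ ≤ a i) (hj : γ ≤ a j) :
    ‖(∑ l, a l • u l) - z‖ ^ 2 + γ / 2 * ‖u i - u j‖ ^ 2 ≤ ∑ l, a l * ‖u l - z‖ ^ 2 := by
  classical
  rcases eq_or_ne i j with rfl | hij
  · simpa using norm_sum_smul_sub_sq_le u z ha0 ha
  rw [sum_mul_norm_sub_sq_eq_add_norm_sum_smul_sub_sq u z ha, add_comm]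
  set v := ∑ l, a l • u l
  gcongr
  calc γ / 2 * ‖u i - u j‖ ^ 2
      ≤ γ / 2 * (2 * (‖u i - v‖ ^ 2 + ‖u j - v‖ ^ 2)) := by
        gcongr
        exact norm_sub_sq_le_two_mul_add _ _ _
    _ = γ * ‖u i - v‖ ^ 2 + γ * ‖u j - v‖ ^ 2 := by ring
    _ ≤ a i * ‖u i - v‖ ^ 2 + a j * ‖u j - v‖ ^ 2 := by gcongr
    _ = ∑ l ∈ {i, j}, a l * ‖u l - v‖ ^ 2 :=
        (Finset.sum_pair (f := fun l => a l * ‖u l - v‖ ^ 2) hij).symm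
    _ ≤ ∑ l, a l * ‖u l - v‖ ^ 2 :=
        Finset.sum_le_sum_of_subset_of_nonneg (Finset.subset_univ _)
          fun l _ _ => mul_nonneg (ha0 l) (sq_nonneg _)

end WeightedAverages

section Young

theorem sq_add_le_one_add_mul_sq_add (s t : ℝ) {θ : ℝ} (hθ : 0 < θ) :
    (s + t) ^ 2 ≤ (1 + θ) * s ^ 2 + (1 + 1 / θ) * t ^ 2 := by
  have : (1 + θ) * s ^ 2 + (1 + 1 / θ) * t ^ 2 - (s + t) ^ 2 = (θ * s - t) ^ 2 / θ := by
    field_simp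
    ring
  have : 0 ≤ (θ * s - t) ^ 2 / θ := by positivity
  linarith

theorem mul_le_sq_mul_add_sq_div (s t : ℝ) {r : ℝ} (hr : 0 < r) :
    s * t ≤ s ^ 2 * r + t ^ 2 / r := by
  have : s ^ 2 * r + t ^ 2 / r - s * t = ((s * r) ^ 2 + t ^ 2 + (s * r - t) ^ 2) / (2 * r) := by
    field_simp
    ring
  have : 0 ≤ ((s * r) ^ 2 + t ^ 2 + (s * r - t) ^ 2) / (2 * r) := by positivity
  linarith

end Young

section Projection

variable {n : ℕ} {X : Set (EuclideanSpace ℝ (Fin n))}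

theorem euclProj_eq_self (hc : IsClosed X) (hv : Convex ℝ X) {u : EuclideanSpace ℝ (Fin n)}
    (hu : u ∈ X) : euclProj X u = u :=
  (euclProj_eq_iff hc hv ⟨u, hu⟩ u u).2 ⟨hu, fun z _ => by simp⟩

theorem inner_sub_euclProj_nonpos (hc : IsClosed X) (hv : Convex ℝ X)
    (u : EuclideanSpace ℝ (Fin n)) {z : EuclideanSpace ℝ (Fin n)} (hz : z ∈ X) :
    inner ℝ (u - euclProj X u) (z - euclProj X u) ≤ 0 := by
  obtain ⟨hs, hmin⟩ := euclProj_spec hc ⟨z, hz⟩ u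
  have : Nonempty X := ⟨⟨z, hz⟩⟩
  refine (norm_eq_iInf_iff_real_inner_le_zero hv hs).1 (le_antisymm ?_ ?_) z hz
  · exact le_ciInf fun z => hmin z z.2
  · exact ciInf_le ⟨0, by rintro _ ⟨z, rfl⟩; exact norm_nonneg _⟩ (⟨_, hs⟩ : X)

theorem norm_euclProj_sub_euclProj_le (hc : IsClosed X) (hv : Convex ℝ X) (hne : X.Nonempty)
    (u w : EuclideanSpace ℝ (Fin n)) : ‖euclProj X u - euclProj X w‖ ≤ ‖u - w‖ := by
  have hu := inner_sub_euclProj_nonpos hc hv u (euclProj_spec hc hne w).1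
  have hw := inner_sub_euclProj_nonpos hc hv w (euclProj_spec hc hne u).1
  set p := euclProj X u
  set q := euclProj X w
  have inner_eq : inner ℝ (u - w) (p - q) =
      ‖p - q‖ ^ 2 - inner ℝ (u - p) (q - p) - inner ℝ (w - q) (p - q) := by
    rw [← real_inner_self_eq_norm_sq, ← neg_sub p q, inner_neg_right, sub_neg_eq_add,
      ← inner_add_left, ← inner_sub_left]
    congr 1
    abel
  have sq_le : ‖p - q‖ ^ 2 ≤ ‖u - w‖ * ‖p - q‖ := by
    linarith [real_inner_le_norm (u - w) (p - q)]
  by_contra! h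
  nlinarith [norm_nonneg (u - w)]

theorem continuous_euclProj (hc : IsClosed X) (hv : Convex ℝ X) (hne : X.Nonempty) :
    Continuous (euclProj X) :=
  (LipschitzWith.of_dist_le_mul (K := 1) fun u w => by
    simpa [dist_eq_norm] using norm_euclProj_sub_euclProj_le hc hv hne u w).continuous

end Projection

section Sequences

theorem summable_mul_of_le_one_sub_mul_add {w θ b : ℕ → ℝ} (hw : ∀ k, 0 ≤ w k) (hθ : ∀ k, 0 ≤ θ k)
    (hb : Summable b) (h : ∀ k, w (k + 1) ≤ (1 - θ k) * w k + b k) :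
    Summable fun k => θ k * w k := by
  have telescoped : ∀ N,
      w N + ∑ k ∈ Finset.range N, θ k * w k ≤ w 0 + ∑ k ∈ Finset.range N, b k := by
    intro N
    induction N with
    | zero => simp
    | succ N ih =>
      rw [Finset.sum_range_succ, Finset.sum_range_succ]
      linarith [h N]
  obtain ⟨c, hc⟩ := hb.hasSum.tendsto_sum_nat.bddAbove_range
  refine summable_of_sum_range_le (c := w 0 + c) (fun k => mul_nonneg (hθ k) (hw k)) fun N => ?_
  linarith [telescoped N, hw N, hc ⟨N, rfl⟩]

theorem exists_tendsto_of_le_add_summable {u b : ℕ → ℝ} (hu : ∀ k, 0 ≤ u k) (hb : Summable b)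
    (h : ∀ k, u (k + 1) ≤ u k + b k) : ∃ ℓ, Tendsto u atTop (𝓝 ℓ) := by
  have hB := hb.hasSum.tendsto_sum_nat
  have hanti : Antitone fun k => u k - ∑ l ∈ Finset.range k, b l := by
    refine antitone_nat_of_succ_le fun k => ?_
    rw [Finset.sum_range_succ]
    linarith [h k]
  obtain ⟨c, hc⟩ := hB.bddAbove_range
  have hbdd : BddBelow (range fun k => u k - ∑ l ∈ Finset.range k, b l) :=
    ⟨-c, forall_mem_range.2 fun k => by linarith [hu k, hc ⟨k, rfl⟩]⟩
  have hlim := (tendsto_atTop_ciInf hanti hbdd).add hB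
  simp only [sub_add_cancel] at hlim
  exact ⟨_, hlim⟩

theorem tendsto_zero_of_le_add_summable_of_summable_mul {u θ b : ℕ → ℝ} (hu : ∀ k, 0 ≤ u k)
    (hb : Summable b) (h : ∀ k, u (k + 1) ≤ u k + b k) (hθu : Summable fun k => θ k * u k)
    (hθ : ¬ Summable θ) : Tendsto u atTop (𝓝 0) := by
  obtain ⟨ℓ, hℓ⟩ := exists_tendsto_of_le_add_summable hu hb h
  rcases eq_or_ne ℓ 0 with rfl | hne
  · exact hℓ
  refine absurd (summable_of_isBigO_nat hθu ?_) hθ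
  have hinv : (fun k => (u k)⁻¹) =O[atTop] fun _ => (1 : ℝ) := (hℓ.inv₀ hne).isBigO_one ℝ
  refine ((Asymptotics.isBigO_refl (fun k => θ k * u k) atTop).mul hinv).congr' ?_ (by simp)
  filter_upwards [hℓ.eventually_ne hne] with k hk
  exact mul_inv_cancel_right₀ hk _

end Sequences

section Stepsizes

variable {ε : ℕ → ℝ}

theorem exists_abs_le_div_add_one_of_isBigO (hε : ε =O[atTop] fun k : ℕ => (k : ℝ)⁻¹) :
    ∃ c : ℝ, 0 < c ∧ ∀ k : ℕ, |ε k| ≤ c / (k + 1) := by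
  have hinv : (fun k : ℕ => (k : ℝ)⁻¹) =O[atTop] fun k : ℕ => ((k : ℝ) + 1)⁻¹ := by
    refine Asymptotics.IsBigO.of_bound 2 ((eventually_ge_atTop 1).mono fun k hk => ?_)
    have hk' : (1 : ℝ) ≤ k := by exact_mod_cast hk
    rw [Real.norm_of_nonneg (by positivity), Real.norm_of_nonneg (by positivity),
      ← div_eq_mul_inv, inv_le_comm₀ (by positivity) (by positivity), inv_div]
    linarith
  obtain ⟨c, hc0, hc⟩ := Asymptotics.bound_of_isBigO_nat_atTop (hε.trans hinv)
  refine ⟨c, hc0, fun k => ?_⟩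
  have bound := hc (x := k) (by positivity)
  rwa [Real.norm_eq_abs, Real.norm_of_nonneg (by positivity), ← div_eq_mul_inv] at bound

theorem LimitingStepsizes.isBigO_inv {α : ℕ → ℝ} (hα : LimitingStepsizes α) :
    α =O[atTop] fun k : ℕ => (k : ℝ)⁻¹ := by
  refine Asymptotics.isBigO_of_div_tendsto_nhds ?_ 0 ?_
  · filter_upwards [eventually_ne_atTop 0] with k hk h
    simp [hk] at h
  · simpa [div_inv_eq_mul, mul_comm, Pi.div_def] using hα 0 one_pos

theorem sum_range_le_mul_one_add_log {c : ℝ} (hε : ∀ k : ℕ, ε k ≤ c / (k + 1)) (hc : 0 ≤ c)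
    (k : ℕ) : ∑ l ∈ Finset.range k, ε l ≤ c * (1 + Real.log k) :=
  calc ∑ l ∈ Finset.range k, ε l ≤ ∑ l ∈ Finset.range k, c / ((l : ℝ) + 1) :=
        Finset.sum_le_sum fun l _ => hε l
    _ = c * (harmonic k : ℝ) := by simp [harmonic, Finset.mul_sum, div_eq_mul_inv]
    _ ≤ c * (1 + Real.log k) := mul_le_mul_of_nonneg_left (harmonic_le_one_add_log k) hc

theorem exists_add_sum_range_le_mul_rpow (hε : ε =O[atTop] fun k : ℕ => (k : ℝ)⁻¹) (R : ℝ)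
    {s : ℝ} (hs : 0 < s) :
    ∃ B : ℝ, 0 < B ∧ ∀ k : ℕ, R + ∑ l ∈ Finset.range k, ε l ≤ B * ((k : ℝ) + 1) ^ s := by
  obtain ⟨c, hc0, hc⟩ := exists_abs_le_div_add_one_of_isBigO hε
  refine ⟨|R| + c * (1 + 1 / s), by positivity, fun k => ?_⟩
  set r := ((k : ℝ) + 1) ^ s
  have one_le : 1 ≤ r := Real.one_le_rpow (by simp) hs.le
  have log_le : Real.log k ≤ r / s :=
    (Real.log_le_rpow_div k.cast_nonneg hs).trans
      (by gcongr; exact Real.rpow_le_rpow k.cast_nonneg (by simp) hs.le)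
  calc R + ∑ l ∈ Finset.range k, ε l
      ≤ |R| * 1 + c * (1 + Real.log k) := by
        rw [mul_one]
        exact add_le_add (le_abs_self R)
          (sum_range_le_mul_one_add_log (fun l => (le_abs_self _).trans (hc l)) hc0.le k)
    _ ≤ |R| * r + c * (r + r / s) := by gcongr
    _ = (|R| + c * (1 + 1 / s)) * r := by ring

theorem summable_sq_mul_sqrt (hε : ε =O[atTop] fun k : ℕ => (k : ℝ)⁻¹) :
    Summable fun k : ℕ => ε k ^ 2 * √((k : ℝ) + 1) := by
  obtain ⟨c, -, hc⟩ := exists_abs_le_div_add_one_of_isBigO hε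
  have hsum : Summable fun k : ℕ => c ^ 2 * (1 / ((k + 1 : ℕ) : ℝ) ^ (3 / 2 : ℝ)) :=
    ((summable_nat_add_iff (f := fun k : ℕ => 1 / (k : ℝ) ^ (3 / 2 : ℝ)) 1).2
      (Real.summable_one_div_nat_rpow.2 (by norm_num))).mul_left _
  refine Summable.of_nonneg_of_le (fun k => by positivity) (fun k => ?_) hsum
  have hk : (0 : ℝ) < (k : ℝ) + 1 := by positivity
  have split_sq : ((k : ℝ) + 1) ^ 2 = ((k : ℝ) + 1) ^ (3 / 2 : ℝ) * √((k : ℝ) + 1) := by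
    rw [Real.sqrt_eq_rpow, ← Real.rpow_add hk, ← Real.rpow_natCast]
    norm_num
  have := Real.sqrt_pos.2 hk
  calc ε k ^ 2 * √((k : ℝ) + 1) ≤ (c / (k + 1)) ^ 2 * √((k : ℝ) + 1) := by
        rw [← sq_abs]
        gcongr
        exact hc k
    _ = c ^ 2 * (1 / ((k + 1 : ℕ) : ℝ) ^ (3 / 2 : ℝ)) := by
        rw [div_pow, split_sq]
        push_cast
        field_simp

theorem not_summable_one_div_sqrt : ¬ Summable fun k : ℕ => 1 / √((k : ℝ) + 1) := by
  have h := (summable_nat_add_iff (f := fun k : ℕ => 1 / (k : ℝ) ^ (1 / 2 : ℝ)) 1).not.2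
    (Real.summable_one_div_nat_rpow.not.2 (by norm_num))
  simpa only [Nat.cast_add, Nat.cast_one, ← Real.sqrt_eq_rpow] using h

theorem exists_div_sqrt_le_commLowerBound {δ K C B : ℝ} (hδ : 0 < δ) (hK : 0 < K) (hC : 0 < C)
    (hB : 0 < B) :
    ∃ q : ℝ, 0 < q ∧ ∀ (k : ℕ) (r : ℝ), 0 ≤ r → r ≤ B * ((k : ℝ) + 1) ^ (1 / (2 * C)) →
      q / √((k : ℝ) + 1) ≤ commLowerBound δ K C r := by
  have hq : 0 < min δ (K / B ^ C) := by positivity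
  refine ⟨min δ (K / B ^ C), hq, fun k r hr0 hr => ?_⟩
  have le_δ : min δ (K / B ^ C) / √((k : ℝ) + 1) ≤ δ :=
    (div_le_self hq.le (Real.one_le_sqrt.2 (by simp))).trans (min_le_left _ _)
  unfold commLowerBound
  split_ifs with h0
  · exact le_δ
  have : 0 < r := lt_of_le_of_ne hr0 (Ne.symm h0)
  have rpow_le : r ^ C ≤ B ^ C * √((k : ℝ) + 1) := by
    calc r ^ C ≤ (B * ((k : ℝ) + 1) ^ (1 / (2 * C))) ^ C := by gcongr
      _ = B ^ C * √((k : ℝ) + 1) := by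
        rw [Real.mul_rpow hB.le (by positivity), ← Real.rpow_mul (by positivity),
          Real.sqrt_eq_rpow]
        congr 2
        field_simp
  refine le_min le_δ ?_
  calc min δ (K / B ^ C) / √((k : ℝ) + 1) ≤ K / B ^ C / √((k : ℝ) + 1) := by
        gcongr
        exact min_le_right _ _
    _ = K / (B ^ C * √((k : ℝ) + 1)) := div_div _ _ _
    _ ≤ K / r ^ C := by gcongr

end Stepsizes

section Disagreement

variable {m n : ℕ}

/-- The total squared deviation `∑ i, ‖x i - y‖ ^ 2` of the estimates from their average `y`, the
Lyapunov function of the consensus argument. -/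
noncomputable def disagreement (x : NetState m n) : ℝ :=
  ∑ i, ‖x i - averageEstimate x‖ ^ 2

theorem disagreement_nonneg (x : NetState m n) : 0 ≤ disagreement x :=
  Finset.sum_nonneg fun _ _ => sq_nonneg _

theorem norm_sub_averageEstimate_sq_le (x : NetState m n) (i : Fin m) :
    ‖x i - averageEstimate x‖ ^ 2 ≤ disagreement x :=
  Finset.single_le_sum (f := fun i => ‖x i - averageEstimate x‖ ^ 2)
    (fun _ _ => sq_nonneg _) (Finset.mem_univ i)

theorem disagreement_le_sum_norm_sub_sq (x : NetState m n) (z : EuclideanSpace ℝ (Fin n)) :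
    disagreement x ≤ ∑ i, ‖x i - z‖ ^ 2 := by
  rcases Nat.eq_zero_or_pos m with rfl | hm
  · simp [disagreement]
  have hm' : (0 : ℝ) < m := by exact_mod_cast hm
  have variance := sum_mul_norm_sub_sq_eq_add_norm_sum_smul_sub_sq
    (a := fun _ : Fin m => 1 / (m : ℝ)) x z (by simp [hm'.ne'])
  simp only [← Finset.mul_sum, ← Finset.smul_sum] at variance
  refine le_of_mul_le_mul_left ?_ (one_div_pos.2 hm')
  rw [variance]
  exact le_add_of_nonneg_right (sq_nonneg _)

theorem disagreement_le_of_norm_sub_le {u v : NetState m n} {ε θ : ℝ} (hθ : 0 < θ) (hθ1 : θ ≤ 1)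
    (h : ∀ i, ‖u i - v i‖ ≤ ε) :
    disagreement u ≤ (1 + θ) * disagreement v + 2 * m * (ε ^ 2 / θ) := by
  have pointwise : ∀ i, ‖u i - averageEstimate v‖ ^ 2 ≤
      (1 + θ) * ‖v i - averageEstimate v‖ ^ 2 + 2 * (ε ^ 2 / θ) := by
    intro i
    have triangle : ‖u i - averageEstimate v‖ ≤ ‖v i - averageEstimate v‖ + ε := by
      rw [← sub_add_sub_cancel (u i) (v i), add_comm]
      exact (norm_add_le _ _).trans (by gcongr; exact h i)
    have one_le : 1 ≤ 1 / θ := (one_le_div hθ).2 hθ1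
    calc ‖u i - averageEstimate v‖ ^ 2 ≤ (‖v i - averageEstimate v‖ + ε) ^ 2 := by gcongr
      _ ≤ (1 + θ) * ‖v i - averageEstimate v‖ ^ 2 + (1 + 1 / θ) * ε ^ 2 :=
          sq_add_le_one_add_mul_sq_add _ _ hθ
      _ ≤ (1 + θ) * ‖v i - averageEstimate v‖ ^ 2 + (1 / θ + 1 / θ) * ε ^ 2 := by gcongr
      _ = (1 + θ) * ‖v i - averageEstimate v‖ ^ 2 + 2 * (ε ^ 2 / θ) := by ring
  calc disagreement u ≤ ∑ i, ‖u i - averageEstimate v‖ ^ 2 := disagreement_le_sum_norm_sub_sq _ _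
    _ ≤ ∑ i, ((1 + θ) * ‖v i - averageEstimate v‖ ^ 2 + 2 * (ε ^ 2 / θ)) :=
        Finset.sum_le_sum fun i _ => pointwise i
    _ = (1 + θ) * disagreement v + 2 * m * (ε ^ 2 / θ) := by
        simp only [Finset.sum_add_distrib, ← Finset.mul_sum, Finset.sum_const, Finset.card_univ,
          Fintype.card_fin, nsmul_eq_mul, disagreement]
        ring

end Disagreement

section Mixing

variable {m n : ℕ} {a : Matrix (Fin m) (Fin m) ℝ}

theorem mixedEstimate_mem (ha : a ∈ doublyStochastic ℝ (Fin m)) {x : NetState m n}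
    {X : Set (EuclideanSpace ℝ (Fin n))} (hX : Convex ℝ X) (hx : ∀ i, x i ∈ X) (i : Fin m) :
    mixedEstimate a x i ∈ X :=
  hX.sum_mem (fun _ _ => nonneg_of_mem_doublyStochastic ha)
    (sum_row_of_mem_doublyStochastic ha i) (fun j _ => hx j)

theorem norm_mixedEstimate_le (ha : a ∈ doublyStochastic ℝ (Fin m)) {x : NetState m n} {R : ℝ}
    (hx : ∀ i, ‖x i‖ ≤ R) (i : Fin m) : ‖mixedEstimate a x i‖ ≤ R :=
  mem_closedBall_zero_iff.1 <| mixedEstimate_mem ha (convex_closedBall 0 R)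
    (fun j => mem_closedBall_zero_iff.2 (hx j)) i

theorem sum_weighted_norm_sub_sq_eq (ha : a ∈ doublyStochastic ℝ (Fin m)) (x : NetState m n)
    (z : EuclideanSpace ℝ (Fin n)) :
    ∑ l, ∑ k, a l k * ‖x k - z‖ ^ 2 = ∑ k, ‖x k - z‖ ^ 2 := by
  rw [Finset.sum_comm]
  simp only [← Finset.sum_mul, sum_col_of_mem_doublyStochastic ha, one_mul]

theorem disagreement_mixedEstimate_le (ha : a ∈ doublyStochastic ℝ (Fin m)) (x : NetState m n) :
    disagreement (mixedEstimate a x) ≤ disagreement x :=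
  calc disagreement (mixedEstimate a x) ≤ ∑ l, ‖mixedEstimate a x l - averageEstimate x‖ ^ 2 :=
        disagreement_le_sum_norm_sub_sq _ _
    _ ≤ ∑ l, ∑ k, a l k * ‖x k - averageEstimate x‖ ^ 2 :=
        Finset.sum_le_sum fun l _ => norm_sum_smul_sub_sq_le _ _
          (fun _ => nonneg_of_mem_doublyStochastic ha) (sum_row_of_mem_doublyStochastic ha l)
    _ = disagreement x := sum_weighted_norm_sub_sq_eq ha _ _

theorem disagreement_mixedEstimate_add_le (ha : a ∈ doublyStochastic ℝ (Fin m)) (x : NetState m n)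
    {γ : ℝ} (hγ : 0 ≤ γ) {i j : Fin m} (hi : γ ≤ a i i) (hj : γ ≤ a i j) :
    disagreement (mixedEstimate a x) + γ / 2 * ‖x i - x j‖ ^ 2 ≤ disagreement x := by
  have nonneg : ∀ l k, 0 ≤ a l k := fun _ _ => nonneg_of_mem_doublyStochastic ha
  have row := sum_row_of_mem_doublyStochastic ha
  set z := averageEstimate x
  calc disagreement (mixedEstimate a x) + γ / 2 * ‖x i - x j‖ ^ 2
      ≤ ∑ l, ‖mixedEstimate a x l - z‖ ^ 2 + γ / 2 * ‖x i - x j‖ ^ 2 := by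
        gcongr
        exact disagreement_le_sum_norm_sub_sq _ _
    _ = (‖mixedEstimate a x i - z‖ ^ 2 + γ / 2 * ‖x i - x j‖ ^ 2) +
          ∑ l ∈ Finset.univ.erase i, ‖mixedEstimate a x l - z‖ ^ 2 := by
        rw [← Finset.add_sum_erase _ _ (Finset.mem_univ i), add_right_comm]
    _ ≤ ∑ k, a i k * ‖x k - z‖ ^ 2 +
          ∑ l ∈ Finset.univ.erase i, ∑ k, a l k * ‖x k - z‖ ^ 2 :=
        add_le_add (norm_sum_smul_sub_sq_add_le x z (nonneg i) (row i) hγ hi hj)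
          (Finset.sum_le_sum fun l _ => norm_sum_smul_sub_sq_le x z (nonneg l) (row l))
    _ = ∑ l, ∑ k, a l k * ‖x k - z‖ ^ 2 :=
        Finset.add_sum_erase _ (fun l => ∑ k, a l k * ‖x k - z‖ ^ 2) (Finset.mem_univ i)
    _ = disagreement x := sum_weighted_norm_sub_sq_eq ha _ _

end Mixing

section Connectivity

variable {m n : ℕ} {G : Digraph (Fin m)}

/-- Weak connectivity: any two vertices are joined by a path whose edges may be traversed in
either direction. It suffices for consensus because the weights are doubly stochastic. -/
def WeaklyConnectedDigraph {V : Type*} (G : Digraph V) : Prop :=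
  ∀ u v, Relation.EqvGen G.Adj u v

theorem StronglyConnectedDigraph.weaklyConnectedDigraph {V : Type*} {G : Digraph V}
    (hG : StronglyConnectedDigraph G) : WeaklyConnectedDigraph G :=
  fun u v => Relation.EqvGen.reflTransGen_le_eqvGen _ u v (hG u v)

open Classical in
/-- The sum of the squared differences of the estimates along the edges of a digraph, by which
connectivity controls the disagreement. -/
noncomputable def edgeEnergy (G : Digraph (Fin m)) (x : NetState m n) : ℝ :=
  ∑ p : Fin m × Fin m with G.Adj p.2 p.1, ‖x p.1 - x p.2‖ ^ 2

theorem edgeEnergy_nonneg (x : NetState m n) : 0 ≤ edgeEnergy G x :=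
  Finset.sum_nonneg fun _ _ => sq_nonneg _

theorem norm_sub_le_sqrt_edgeEnergy {i j : Fin m} (h : G.Adj j i) (x : NetState m n) :
    ‖x i - x j‖ ≤ √(edgeEnergy G x) := by
  classical
  exact Real.le_sqrt_of_sq_le <|
    Finset.single_le_sum (f := fun p : Fin m × Fin m => ‖x p.1 - x p.2‖ ^ 2)
      (fun _ _ => sq_nonneg _) (a := (i, j)) (by simpa using h)

theorem exists_norm_sub_le_mul_sqrt_edgeEnergy {u v : Fin m} (h : Relation.EqvGen G.Adj u v) :
    ∃ N : ℕ, ∀ x : NetState m n, ‖x u - x v‖ ≤ N * √(edgeEnergy G x) := by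
  induction h with
  | rel u v huv => exact ⟨1, fun x => by
      rw [norm_sub_rev, Nat.cast_one, one_mul]
      exact norm_sub_le_sqrt_edgeEnergy huv x⟩
  | refl u => exact ⟨0, by simp⟩
  | symm u v _ ih =>
    obtain ⟨N, hN⟩ := ih
    exact ⟨N, fun x => norm_sub_rev (x v) (x u) ▸ hN x⟩
  | trans u v w _ _ ihu ihw =>
    obtain ⟨N, hN⟩ := ihu
    obtain ⟨N', hN'⟩ := ihw
    refine ⟨N + N', fun x => ?_⟩
    rw [Nat.cast_add, add_mul]
    exact (norm_sub_le_norm_sub_add_norm_sub _ _ _).trans (add_le_add (hN x) (hN' x))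

theorem WeaklyConnectedDigraph.exists_disagreement_le_mul_edgeEnergy
    (hG : WeaklyConnectedDigraph G) :
    ∃ N : ℝ, 0 < N ∧ ∀ x : NetState m n, disagreement x ≤ N * edgeEnergy G x := by
  rcases Nat.eq_zero_or_pos m with rfl | hm
  · exact ⟨1, one_pos, fun x => by simp [disagreement, edgeEnergy]⟩
  choose N hN using fun i => exists_norm_sub_le_mul_sqrt_edgeEnergy (n := n) (hG i ⟨0, hm⟩)
  refine ⟨∑ i, (N i : ℝ) ^ 2 + 1, by positivity, fun x => ?_⟩
  have sq_le : ∀ i, ‖x i - x ⟨0, hm⟩‖ ^ 2 ≤ (N i : ℝ) ^ 2 * edgeEnergy G x := fun i => by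
    simpa only [mul_pow, Real.sq_sqrt (edgeEnergy_nonneg x)] using
      pow_le_pow_left₀ (norm_nonneg _) (hN i x) 2
  calc disagreement x ≤ ∑ i, ‖x i - x ⟨0, hm⟩‖ ^ 2 := disagreement_le_sum_norm_sub_sq _ _
    _ ≤ ∑ i, (N i : ℝ) ^ 2 * edgeEnergy G x := Finset.sum_le_sum fun i _ => sq_le i
    _ = (∑ i, (N i : ℝ) ^ 2) * edgeEnergy G x := (Finset.sum_mul _ _ _).symm
    _ ≤ (∑ i, (N i : ℝ) ^ 2 + 1) * edgeEnergy G x :=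
        mul_le_mul_of_nonneg_right (le_add_of_nonneg_right zero_le_one) (edgeEnergy_nonneg x)

end Connectivity

section Measurability

variable {m n : ℕ} {Ω : Type*} [MeasurableSpace Ω]

theorem measurable_disagreement : Measurable (disagreement : NetState m n → ℝ) := by
  unfold disagreement averageEstimate
  fun_prop

theorem measurable_mixedEstimate {M : Ω → Matrix (Fin m) (Fin m) ℝ} {Z : Ω → NetState m n}
    (hM : ∀ i j, Measurable fun ω => M ω i j) (hZ : Measurable Z) :
    Measurable fun ω => mixedEstimate (M ω) (Z ω) := by
  unfold mixedEstimate
  fun_prop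

theorem noiseHistory_le {Ω' : Type*} [MeasurableSpace Ω'] {ξ : ℕ → Ω → Ω'}
    (hξ : ∀ k, Measurable (ξ k)) (k : ℕ) : noiseHistory ξ k ≤ ‹MeasurableSpace Ω› :=
  iSup₂_le fun j _ => (hξ j).comap_le

end Measurability

section Probability

variable {Ω : Type*}

theorem ae_summable_of_summable_integral {mΩ : MeasurableSpace Ω} {P : Measure Ω}
    {F : ℕ → Ω → ℝ} (hF : ∀ k ω, 0 ≤ F k ω) (hint : ∀ k, Integrable (F k) P)
    (h : Summable fun k => ∫ ω, F k ω ∂P) : ∀ᵐ ω ∂P, Summable fun k => F k ω := by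
  have hmeas : ∀ k, AEMeasurable (fun ω => ENNReal.ofReal (F k ω)) P :=
    fun k => (hint k).aemeasurable.ennreal_ofReal
  have hfin : ∫⁻ ω, ∑' k, ENNReal.ofReal (F k ω) ∂P ≠ ⊤ := by
    rw [lintegral_tsum hmeas]
    simp_rw [← ofReal_integral_eq_lintegral_ofReal (hint _) (ae_of_all _ (hF _))]
    exact h.tsum_ofReal_ne_top
  filter_upwards [ae_lt_top' (AEMeasurable.tsum hmeas) hfin] with ω hω
  simpa only [ENNReal.toReal_ofReal (hF _ ω)] using ENNReal.summable_toReal hω.ne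

theorem mul_integral_le_integral_indicator {𝓖 mΩ : MeasurableSpace Ω} {P : Measure Ω}
    [IsFiniteMeasure P] (h𝓖 : 𝓖 ≤ mΩ) {s : Set Ω} (hs : MeasurableSet s) {g : Ω → ℝ}
    (hg : StronglyMeasurable[𝓖] g) (hg0 : ∀ ω, 0 ≤ g ω) (hint : Integrable g P) {q : ℝ}
    (hq : ∀ᵐ ω ∂P, q ≤ (P⟦s | 𝓖⟧) ω) :
    q * ∫ ω, g ω ∂P ≤ ∫ ω, s.indicator g ω ∂P := by
  have indicator_eq : s.indicator g = s.indicator (fun _ => (1 : ℝ)) * g := by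
    ext ω
    by_cases hω : ω ∈ s <;> simp [hω]
  have hint' : Integrable (s.indicator (fun _ => (1 : ℝ)) * g) P :=
    indicator_eq ▸ hint.indicator hs
  have pull_out := condExp_mul_of_stronglyMeasurable_right hg hint'
    ((integrable_const (1 : ℝ)).indicator hs)
  rw [← integral_const_mul, indicator_eq, ← integral_condExp h𝓖 (f := s.indicator _ * g)]
  refine integral_mono_ae (hint.const_mul q) integrable_condExp ?_
  filter_upwards [pull_out, hq] with ω hω hqω
  rw [hω]
  exact mul_le_mul_of_nonneg_right hqω (hg0 ω)

end Probability

section Convergence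

variable {m n : ℕ}

theorem tendsto_disagreement_zero {u : ℕ → NetState m n} {ε : ℕ → ℝ}
    (hε : ε =O[atTop] fun k : ℕ => (k : ℝ)⁻¹)
    (h : ∀ k, ∀ θ : ℝ, 0 < θ → θ ≤ 1 →
      disagreement (u (k + 1)) ≤ (1 + θ) * disagreement (u k) + 2 * m * (ε k ^ 2 / θ))
    (hu : Summable fun k : ℕ => 1 / √((k : ℝ) + 1) * disagreement (u k)) :
    Tendsto (fun k => disagreement (u k)) atTop (𝓝 0) := by
  have error_summable : Summable fun k : ℕ => 2 * m * (ε k ^ 2 / (1 / √((k : ℝ) + 1))) := by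
    simpa only [div_div_eq_mul_div, div_one] using (summable_sq_mul_sqrt hε).mul_left (2 * (m : ℝ))
  refine tendsto_zero_of_le_add_summable_of_summable_mul (fun k => disagreement_nonneg _)
    (hu.add error_summable) (fun k => ?_) hu not_summable_one_div_sqrt
  have one_div_sqrt_le_one : 1 / √((k : ℝ) + 1) ≤ 1 :=
    div_le_one_of_le₀ (Real.one_le_sqrt.2 (by simp)) (Real.sqrt_nonneg _)
  linarith [h k _ (by positivity) one_div_sqrt_le_one]

theorem tendsto_norm_sub_averageEstimate {u : ℕ → NetState m n}
    (hu : Tendsto (fun k => disagreement (u k)) atTop (𝓝 0)) (i : Fin m) :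
    Tendsto (fun k => ‖u k i - averageEstimate (u k)‖) atTop (𝓝 0) := by
  refine squeeze_zero (fun k => norm_nonneg _) (fun k => Real.le_sqrt_of_sq_le <|
    norm_sub_averageEstimate_sq_le (u k) i) ?_
  simpa using hu.sqrt

theorem summable_mul_norm_sub_averageEstimate {u : ℕ → NetState m n} {α : ℕ → ℝ}
    (hα : α =O[atTop] fun k : ℕ => (k : ℝ)⁻¹)
    (hu : Summable fun k : ℕ => 1 / √((k : ℝ) + 1) * disagreement (u k)) (i : Fin m) :
    Summable fun k => α k * ‖u k i - averageEstimate (u k)‖ := by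
  refine Summable.of_norm_bounded ((summable_sq_mul_sqrt hα).add hu) fun k => ?_
  rw [norm_mul, norm_norm, Real.norm_eq_abs]
  calc |α k| * ‖u k i - averageEstimate (u k)‖
      ≤ |α k| ^ 2 * √((k : ℝ) + 1) +
          ‖u k i - averageEstimate (u k)‖ ^ 2 / √((k : ℝ) + 1) :=
        mul_le_sq_mul_add_sq_div _ _ (by positivity)
    _ ≤ α k ^ 2 * √((k : ℝ) + 1) + 1 / √((k : ℝ) + 1) * disagreement (u k) := by
        rw [sq_abs, one_div_mul_eq_div]
        gcongr
        exact norm_sub_averageEstimate_sq_le _ i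

end Convergence

/-- A random consensus iteration with errors: up to an error of norm at most `ε k`, the estimates
`x (k + 1)` are the averages of the estimates `x k` with the doubly stochastic random weights
`A k`, whose diagonal entries are at least `γ`. This is what remains of the projected subgradient
method once its projected steps are regarded as errors. -/
structure IsPerturbedConsensus {m n : ℕ} {Ω : Type*} [MeasurableSpace Ω] (P : Measure Ω) (γ : ℝ)
    (x : ℕ → Ω → NetState m n) (A : ℕ → Ω → Matrix (Fin m) (Fin m) ℝ) (ε : ℕ → ℝ) : Prop where
  measurable_state : ∀ k, Measurable (x k)
  measurable_weights : ∀ k i j, Measurable fun ω => A k ω i j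
  doublyStochastic : DoublyStochasticWeights P A
  selfConfidence : SelfConfidence P γ A
  bounded_init : ∃ R : ℝ, ∀ᵐ ω ∂P, ∀ i, ‖x 0 ω i‖ ≤ R
  perturbation_le : ∀ k, ∀ᵐ ω ∂P, ∀ i,
    ‖x (k + 1) ω i - mixedEstimate (A k ω) (x k ω) i‖ ≤ ε k

namespace IsPerturbedConsensus

variable {m n : ℕ} {Ω : Type*} [MeasurableSpace Ω] {P : Measure Ω} {γ : ℝ}
  {x : ℕ → Ω → NetState m n} {A : ℕ → Ω → Matrix (Fin m) (Fin m) ℝ} {ε : ℕ → ℝ}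
  {G : Digraph (Fin m)}

theorem exists_ae_norm_le (h : IsPerturbedConsensus P γ x A ε) :
    ∃ R : ℝ, ∀ᵐ ω ∂P, ∀ k i, ‖x k ω i‖ ≤ R + ∑ l ∈ Finset.range k, ε l := by
  obtain ⟨R, hR⟩ := h.bounded_init
  refine ⟨R, ?_⟩
  filter_upwards [hR, ae_all_iff.2 h.doublyStochastic, ae_all_iff.2 h.perturbation_le]
    with ω init stoch step k
  induction k with
  | zero => simpa using init
  | succ k ih =>
    intro i
    calc ‖x (k + 1) ω i‖
        ≤ ‖mixedEstimate (A k ω) (x k ω) i‖ +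
            ‖x (k + 1) ω i - mixedEstimate (A k ω) (x k ω) i‖ := norm_le_insert' _ _
      _ ≤ (R + ∑ l ∈ Finset.range k, ε l) + ε k :=
          add_le_add (norm_mixedEstimate_le (stoch k) ih i) (step k i)
      _ = R + ∑ l ∈ Finset.range (k + 1), ε l := by rw [Finset.sum_range_succ, add_assoc]

theorem exists_div_sqrt_le_condProb {δ K C : ℝ} (h : IsPerturbedConsensus P γ x A ε)
    (hε : ε =O[atTop] fun k : ℕ => (k : ℝ)⁻¹) (hδ : 0 < δ) (hK : 0 < K) (hC : 0 < C)
    (h_comm : DistanceDependentCommunication P G γ δ K C x A) :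
    ∃ q : ℝ, 0 < q ∧ ∀ (k : ℕ) (i j), G.Adj j i → ∀ᵐ ω ∂P, q / √((k : ℝ) + 1) ≤
      (P⟦{ω' | γ ≤ A k ω' i j} | MeasurableSpace.comap (x k) inferInstance⟧) ω := by
  obtain ⟨R, hR⟩ := h.exists_ae_norm_le
  obtain ⟨B, hB0, hB⟩ := exists_add_sum_range_le_mul_rpow hε R (s := 1 / (2 * C)) (by positivity)
  obtain ⟨q, hq0, hq⟩ := exists_div_sqrt_le_commLowerBound hδ hK hC (B := 2 * B) (by positivity)
  refine ⟨q, hq0, fun k i j hij => ?_⟩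
  filter_upwards [hR, h_comm i j hij k] with ω hω hprob
  refine (hq k _ (norm_nonneg _) ?_).trans hprob
  calc ‖x k ω i - x k ω j‖ ≤ ‖x k ω i‖ + ‖x k ω j‖ := norm_sub_le _ _
    _ ≤ 2 * (R + ∑ l ∈ Finset.range k, ε l) := by linarith [hω k i, hω k j]
    _ ≤ 2 * (B * ((k : ℝ) + 1) ^ (1 / (2 * C))) := by gcongr; exact hB k
    _ = 2 * B * ((k : ℝ) + 1) ^ (1 / (2 * C)) := (mul_assoc _ _ _).symm

section Integrability

variable [IsFiniteMeasure P]

theorem integrable_disagreement (h : IsPerturbedConsensus P γ x A ε) (k : ℕ) :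
    Integrable (fun ω => disagreement (x k ω)) P := by
  obtain ⟨R, hR⟩ := h.exists_ae_norm_le
  refine Integrable.of_bound
    (measurable_disagreement.comp (h.measurable_state k)).aestronglyMeasurable
    (∑ _i : Fin m, (R + ∑ l ∈ Finset.range k, ε l) ^ 2) ?_
  filter_upwards [hR] with ω hω
  rw [Real.norm_of_nonneg (disagreement_nonneg _)]
  refine (disagreement_le_sum_norm_sub_sq _ 0).trans (Finset.sum_le_sum fun i _ => ?_)
  rw [sub_zero]
  gcongr
  exact hω k i

theorem integrable_disagreement_mixedEstimate (h : IsPerturbedConsensus P γ x A ε) (k : ℕ) :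
    Integrable (fun ω => disagreement (mixedEstimate (A k ω) (x k ω))) P := by
  refine (h.integrable_disagreement k).mono' (measurable_disagreement.comp
    (measurable_mixedEstimate (h.measurable_weights k)
      (h.measurable_state k))).aestronglyMeasurable ?_
  filter_upwards [h.doublyStochastic k] with ω stoch
  rw [Real.norm_of_nonneg (disagreement_nonneg _)]
  exact disagreement_mixedEstimate_le stoch _

theorem integrable_norm_sub_sq (h : IsPerturbedConsensus P γ x A ε) (k : ℕ) (i j : Fin m) :
    Integrable (fun ω => ‖x k ω i - x k ω j‖ ^ 2) P := by
  have hmeas := h.measurable_state k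
  refine ((h.integrable_disagreement k).const_mul 4).mono'
    (Measurable.aestronglyMeasurable (by fun_prop)) (ae_of_all _ fun ω => ?_)
  rw [Real.norm_of_nonneg (sq_nonneg _)]
  linarith [norm_sub_sq_le_two_mul_add (x k ω i) (x k ω j) (averageEstimate (x k ω)),
    norm_sub_averageEstimate_sq_le (x k ω) i, norm_sub_averageEstimate_sq_le (x k ω) j]

end Integrability

section ExpectedDecrease

variable [IsFiniteMeasure P]

theorem integral_disagreement_mixedEstimate_le (h : IsPerturbedConsensus P γ x A ε) (k : ℕ) :
    ∫ ω, disagreement (mixedEstimate (A k ω) (x k ω)) ∂P ≤ ∫ ω, disagreement (x k ω) ∂P := by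
  refine integral_mono_ae (h.integrable_disagreement_mixedEstimate k)
    (h.integrable_disagreement k) ?_
  filter_upwards [h.doublyStochastic k] with ω stoch
  exact disagreement_mixedEstimate_le stoch _

theorem integral_disagreement_mixedEstimate_add_le (h : IsPerturbedConsensus P γ x A ε)
    (hγ : 0 ≤ γ) {k : ℕ} {i j : Fin m} {q : ℝ} (hq : ∀ᵐ ω ∂P, q ≤
      (P⟦{ω' | γ ≤ A k ω' i j} | MeasurableSpace.comap (x k) inferInstance⟧) ω) :
    ∫ ω, disagreement (mixedEstimate (A k ω) (x k ω)) ∂P +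
      γ / 2 * (q * ∫ ω, ‖x k ω i - x k ω j‖ ^ 2 ∂P) ≤ ∫ ω, disagreement (x k ω) ∂P := by
  set active := {ω | γ ≤ A k ω i j}
  set gap := fun ω => ‖x k ω i - x k ω j‖ ^ 2
  have active_measurable : MeasurableSet active :=
    measurableSet_le measurable_const (h.measurable_weights k i j)
  have gap_measurable : StronglyMeasurable[MeasurableSpace.comap (x k) inferInstance] gap := by
    have sq_measurable : Measurable fun z : NetState m n => ‖z i - z j‖ ^ 2 := by fun_prop
    exact (sq_measurable.comp (comap_measurable (x k))).stronglyMeasurable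
  have gap_integrable := h.integrable_norm_sub_sq k i j
  have active_integrable := (gap_integrable.indicator active_measurable).const_mul (γ / 2)
  calc ∫ ω, disagreement (mixedEstimate (A k ω) (x k ω)) ∂P + γ / 2 * (q * ∫ ω, gap ω ∂P)
      ≤ ∫ ω, disagreement (mixedEstimate (A k ω) (x k ω)) ∂P +
          γ / 2 * ∫ ω, active.indicator gap ω ∂P := by
        gcongr
        exact mul_integral_le_integral_indicator (h.measurable_state k).comap_le
          active_measurable gap_measurable (fun _ => sq_nonneg _) gap_integrable hq
    _ = ∫ ω, (disagreement (mixedEstimate (A k ω) (x k ω)) +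
          γ / 2 * active.indicator gap ω) ∂P := by
        rw [integral_add (h.integrable_disagreement_mixedEstimate k) active_integrable,
          integral_const_mul]
    _ ≤ ∫ ω, disagreement (x k ω) ∂P := by
        refine integral_mono_ae ((h.integrable_disagreement_mixedEstimate k).add active_integrable)
          (h.integrable_disagreement k) ?_
        filter_upwards [h.doublyStochastic k, h.selfConfidence k i] with ω stoch self
        by_cases hω : ω ∈ active
        · rw [indicator_of_mem hω]
          exact disagreement_mixedEstimate_add_le stoch _ hγ self hω
        · rw [indicator_of_notMem hω, mul_zero, add_zero]
          exact disagreement_mixedEstimate_le stoch _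

theorem integrable_edgeEnergy (h : IsPerturbedConsensus P γ x A ε) (k : ℕ) :
    Integrable (fun ω => edgeEnergy G (x k ω)) P :=
  integrable_finsetSum _ fun _ _ => h.integrable_norm_sub_sq k _ _

theorem mul_integral_edgeEnergy_le (h : IsPerturbedConsensus P γ x A ε) (hγ : 0 ≤ γ) {k : ℕ}
    {q : ℝ} (hq : ∀ i j, G.Adj j i → ∀ᵐ ω ∂P, q ≤
      (P⟦{ω' | γ ≤ A k ω' i j} | MeasurableSpace.comap (x k) inferInstance⟧) ω) :
    γ / 2 * q * ∫ ω, edgeEnergy G (x k ω) ∂P ≤ m ^ 2 * (∫ ω, disagreement (x k ω) ∂P -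
      ∫ ω, disagreement (mixedEstimate (A k ω) (x k ω)) ∂P) := by
  classical
  set decrease := ∫ ω, disagreement (x k ω) ∂P -
    ∫ ω, disagreement (mixedEstimate (A k ω) (x k ω)) ∂P
  have decrease_nonneg : 0 ≤ decrease := sub_nonneg.2 (h.integral_disagreement_mixedEstimate_le k)
  unfold edgeEnergy
  rw [integral_finsetSum _ fun _ _ => h.integrable_norm_sub_sq k _ _, Finset.mul_sum]
  calc ∑ p : Fin m × Fin m with G.Adj p.2 p.1, γ / 2 * q * ∫ ω, ‖x k ω p.1 - x k ω p.2‖ ^ 2 ∂P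
      ≤ ∑ p : Fin m × Fin m with G.Adj p.2 p.1, decrease := by
        refine Finset.sum_le_sum fun p hp => ?_
        rw [mul_assoc]
        exact le_sub_iff_add_le'.2 <| h.integral_disagreement_mixedEstimate_add_le hγ
          (hq p.1 p.2 (Finset.mem_filter.1 hp).2)
    _ ≤ ∑ _p : Fin m × Fin m, decrease :=
        Finset.sum_le_sum_of_subset_of_nonneg (Finset.filter_subset _ _)
          fun _ _ _ => decrease_nonneg
    _ = m ^ 2 * decrease := by simp [sq]

theorem exists_integral_disagreement_mixedEstimate_le_one_sub_mul
    (h : IsPerturbedConsensus P γ x A ε) (hγ : 0 < γ) (hG : WeaklyConnectedDigraph G) :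
    ∃ κ : ℝ, 0 < κ ∧ ∀ (k : ℕ) (q : ℝ), 0 ≤ q →
      (∀ i j, G.Adj j i → ∀ᵐ ω ∂P, q ≤
        (P⟦{ω' | γ ≤ A k ω' i j} | MeasurableSpace.comap (x k) inferInstance⟧) ω) →
      ∫ ω, disagreement (mixedEstimate (A k ω) (x k ω)) ∂P ≤
        (1 - κ * q) * ∫ ω, disagreement (x k ω) ∂P := by
  obtain ⟨N, hN0, hN⟩ := hG.exists_disagreement_le_mul_edgeEnergy (n := n)
  set c : ℝ := m ^ 2 + 1
  have hc : 0 < c := by positivity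
  refine ⟨γ / (2 * N * c), by positivity, fun k q hq0 hq => ?_⟩
  set V := ∫ ω, disagreement (x k ω) ∂P
  set S := ∫ ω, disagreement (mixedEstimate (A k ω) (x k ω)) ∂P
  have V_le : V ≤ N * ∫ ω, edgeEnergy G (x k ω) ∂P := by
    rw [← integral_const_mul]
    exact integral_mono (h.integrable_disagreement k) ((h.integrable_edgeEnergy k).const_mul N)
      fun ω => hN (x k ω)
  have S_le : S ≤ V := h.integral_disagreement_mixedEstimate_le k
  have decrease_ge : γ / (2 * N * c) * q * V ≤ V - S :=
    calc γ / (2 * N * c) * q * V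
        ≤ γ / (2 * N * c) * q * (N * ∫ ω, edgeEnergy G (x k ω) ∂P) := by gcongr
      _ = (γ / 2 * q * ∫ ω, edgeEnergy G (x k ω) ∂P) / c := by field_simp
      _ ≤ m ^ 2 * (V - S) / c :=
          div_le_div_of_nonneg_right (h.mul_integral_edgeEnergy_le hγ.le hq) hc.le
      _ ≤ c * (V - S) / c := by
          gcongr
          exact le_add_of_nonneg_right zero_le_one
      _ = V - S := mul_div_cancel_left₀ _ hc.ne'
  linarith

theorem integral_disagreement_succ_le (h : IsPerturbedConsensus P γ x A ε) (k : ℕ) {θ : ℝ}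
    (hθ : 0 < θ) (hθ1 : θ ≤ 1) :
    ∫ ω, disagreement (x (k + 1) ω) ∂P ≤
      (1 + θ) * ∫ ω, disagreement (mixedEstimate (A k ω) (x k ω)) ∂P +
        P.real univ * (2 * m * (ε k ^ 2 / θ)) := by
  have mixed_integrable := (h.integrable_disagreement_mixedEstimate k).const_mul (1 + θ)
  rw [← integral_const_mul, ← smul_eq_mul (P.real univ), ← integral_const,
    ← integral_add mixed_integrable (integrable_const _)]
  refine integral_mono_ae (h.integrable_disagreement (k + 1))
    (mixed_integrable.add (integrable_const _)) ?_
  filter_upwards [h.perturbation_le k] with ω step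
  exact disagreement_le_of_norm_sub_le hθ hθ1 step

end ExpectedDecrease

theorem exists_integral_disagreement_succ_le_one_sub_mul_add [IsFiniteMeasure P]
    (h : IsPerturbedConsensus P γ x A ε) (hγ : 0 < γ) (hG : WeaklyConnectedDigraph G) {q : ℝ}
    (hq0 : 0 < q) (hq : ∀ (k : ℕ) (i j), G.Adj j i → ∀ᵐ ω ∂P, q / √((k : ℝ) + 1) ≤
      (P⟦{ω' | γ ≤ A k ω' i j} | MeasurableSpace.comap (x k) inferInstance⟧) ω) :
    ∃ τ : ℝ, 0 < τ ∧ ∀ k : ℕ, ∫ ω, disagreement (x (k + 1) ω) ∂P ≤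
      (1 - τ / √((k : ℝ) + 1)) * ∫ ω, disagreement (x k ω) ∂P +
        P.real univ * (2 * m * (ε k ^ 2 / (τ / √((k : ℝ) + 1)))) := by
  obtain ⟨κ, hκ0, hκ⟩ := h.exists_integral_disagreement_mixedEstimate_le_one_sub_mul hγ hG
  refine ⟨min (κ * q / 2) 1, by positivity, fun k => ?_⟩
  set τ := min (κ * q / 2) 1
  have hτ0 : 0 < τ := by positivity
  set θ := τ / √((k : ℝ) + 1)
  set V := ∫ ω, disagreement (x k ω) ∂P
  have hθ0 : 0 < θ := by positivity
  have hθ1 : θ ≤ 1 :=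
    (div_le_self hτ0.le (Real.one_le_sqrt.2 (by simp))).trans (min_le_right _ _)
  have hV0 : 0 ≤ V := integral_nonneg fun _ => disagreement_nonneg _
  have two_θ_le : 2 * θ ≤ κ * (q / √((k : ℝ) + 1)) := by
    rw [← mul_div_assoc, ← mul_div_assoc]
    exact div_le_div_of_nonneg_right (by linarith [min_le_left (κ * q / 2) 1])
      (Real.sqrt_nonneg _)
  have contraction := hκ k _ (by positivity) (hq k)
  refine (h.integral_disagreement_succ_le k hθ0 hθ1).trans (add_le_add_left ?_ _)
  calc (1 + θ) * ∫ ω, disagreement (mixedEstimate (A k ω) (x k ω)) ∂P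
      ≤ (1 + θ) * ((1 - κ * (q / √((k : ℝ) + 1))) * V) := by gcongr
    _ ≤ (1 + θ) * ((1 - 2 * θ) * V) := by gcongr
    _ = (1 - θ) * V - 2 * θ ^ 2 * V := by ring
    _ ≤ (1 - θ) * V := sub_le_self _ (by positivity)

theorem ae_summable_one_div_sqrt_mul_disagreement [IsFiniteMeasure P]
    (h : IsPerturbedConsensus P γ x A ε) (hε : ε =O[atTop] fun k : ℕ => (k : ℝ)⁻¹) (hγ : 0 < γ)
    (hG : WeaklyConnectedDigraph G) {q : ℝ} (hq0 : 0 < q)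
    (hq : ∀ (k : ℕ) (i j), G.Adj j i → ∀ᵐ ω ∂P, q / √((k : ℝ) + 1) ≤
      (P⟦{ω' | γ ≤ A k ω' i j} | MeasurableSpace.comap (x k) inferInstance⟧) ω) :
    ∀ᵐ ω ∂P, Summable fun k : ℕ => 1 / √((k : ℝ) + 1) * disagreement (x k ω) := by
  obtain ⟨τ, hτ0, hτ⟩ := h.exists_integral_disagreement_succ_le_one_sub_mul_add hγ hG hq0 hq
  have error_summable : Summable fun k : ℕ =>
      P.real univ * (2 * m * (ε k ^ 2 / (τ / √((k : ℝ) + 1)))) := by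
    simpa only [div_div_eq_mul_div] using
      (((summable_sq_mul_sqrt hε).div_const τ).mul_left _).mul_left _
  have integral_summable := summable_mul_of_le_one_sub_mul_add
    (fun k => integral_nonneg fun _ => disagreement_nonneg _) (fun k => by positivity)
    error_summable hτ
  refine ae_summable_of_summable_integral
    (fun k ω => mul_nonneg (by positivity) (disagreement_nonneg _))
    (fun k => (h.integrable_disagreement k).const_mul _) ?_
  refine (integral_summable.mul_left τ⁻¹).congr fun k => ?_
  rw [integral_const_mul, ← mul_assoc, inv_mul_eq_div, div_div_cancel_left' hτ0.ne', one_div]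

theorem ae_disagreement_succ_le (h : IsPerturbedConsensus P γ x A ε) :
    ∀ᵐ ω ∂P, ∀ k, ∀ θ : ℝ, 0 < θ → θ ≤ 1 → disagreement (x (k + 1) ω) ≤
      (1 + θ) * disagreement (x k ω) + 2 * m * (ε k ^ 2 / θ) := by
  filter_upwards [ae_all_iff.2 h.doublyStochastic, ae_all_iff.2 h.perturbation_le]
    with ω stoch step k θ hθ hθ1
  refine (disagreement_le_of_norm_sub_le hθ hθ1 (step k)).trans ?_
  gcongr
  exact disagreement_mixedEstimate_le (stoch k) _

end IsPerturbedConsensus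

namespace IsProjectedSubgradientMethod

variable {m n : ℕ} {Ω Ω' : Type*} [MeasurableSpace Ω']
  {f : Fin m → EuclideanSpace ℝ (Fin n) → ℝ} {X : Fin m → Set (EuclideanSpace ℝ (Fin n))}
  {α : ℕ → ℝ} {ψ : NetState m n → Ω' → Matrix (Fin m) (Fin m) ℝ} {ξ : ℕ → Ω → Ω'}
  {x₀ : NetState m n} {x : ℕ → Ω → NetState m n} {A : ℕ → Ω → Matrix (Fin m) (Fin m) ℝ}
  {d : ℕ → Ω → NetState m n}

theorem state_mem (hx : IsProjectedSubgradientMethod f X α ψ ξ x₀ x A d)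
    (hX : ∀ i, IsClosed (X i)) (k : ℕ) (ω : Ω) (i : Fin m) : x k ω i ∈ X i := by
  cases k with
  | zero => exact hx.init_eq ω ▸ hx.init_mem i
  | succ k => exact hx.update k ω i ▸ (euclProj_spec (hX i) ⟨_, hx.init_mem i⟩ _).1

theorem measurable_weights [MeasurableSpace Ω]
    (hx : IsProjectedSubgradientMethod f X α ψ ξ x₀ x A d)
    (hψ : ∀ i j, Measurable fun q : NetState m n × Ω' => ψ q.1 q.2 i j)
    (hξ : ∀ k, Measurable (ξ k)) {k : ℕ} (hk : Measurable (x k)) (i j : Fin m) :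
    Measurable fun ω => A k ω i j := by
  simp only [hx.comm_eq]
  exact (hψ i j).comp (hk.prodMk (hξ k))

theorem measurable_state [MeasurableSpace Ω]
    (hx : IsProjectedSubgradientMethod f X α ψ ξ x₀ x A d) (hX : ∀ i, IsClosed (X i))
    (hX' : ∀ i, Convex ℝ (X i))
    (hψ : ∀ i j, Measurable fun q : NetState m n × Ω' => ψ q.1 q.2 i j)
    (hξ : ∀ k, Measurable (ξ k)) (k : ℕ) : Measurable (x k) := by
  induction k with
  | zero =>
    rw [funext hx.init_eq]
    exact measurable_const
  | succ k ih =>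
    refine measurable_pi_lambda _ fun i => ?_
    simp only [hx.update]
    have mixed := measurable_mixedEstimate (hx.measurable_weights hψ hξ ih) ih
    have direction := (hx.nonanticipating k).mono (noiseHistory_le hξ k) le_rfl
    exact (continuous_euclProj (hX i) (hX' i) ⟨_, hx.init_mem i⟩).measurable.comp
      ((measurable_pi_iff.1 mixed i).sub ((measurable_pi_iff.1 direction i).const_smul (α k)))

theorem norm_state_succ_sub_mixedEstimate_le
    (hx : IsProjectedSubgradientMethod f X α ψ ξ x₀ x A d) {L : ℝ}
    (hL : ∀ i u, ∀ s ∈ subgradients (f i) u, ‖s‖ ≤ L) {Y : Set (EuclideanSpace ℝ (Fin n))}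
    (hY : IsClosed Y) (hY' : Convex ℝ Y) (hXY : ∀ i, X i = Y) {k : ℕ} {ω : Ω}
    (stoch : A k ω ∈ doublyStochastic ℝ (Fin m)) (i : Fin m) :
    ‖x (k + 1) ω i - mixedEstimate (A k ω) (x k ω) i‖ ≤ L * |α k| := by
  set v := mixedEstimate (A k ω) (x k ω) i
  have hv : v ∈ Y := mixedEstimate_mem stoch hY'
    (fun j => hXY j ▸ hx.state_mem (fun l => (hXY l).symm ▸ hY) k ω j) i
  calc ‖x (k + 1) ω i - v‖ = ‖euclProj Y (v - α k • d k ω i) - euclProj Y v‖ := by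
        rw [hx.update, hXY, euclProj_eq_self hY hY' hv]
    _ ≤ ‖v - α k • d k ω i - v‖ := norm_euclProj_sub_euclProj_le hY hY' ⟨v, hv⟩ _ _
    _ = ‖d k ω i‖ * |α k| := by
        rw [sub_sub_cancel_left, norm_neg, norm_smul, Real.norm_eq_abs, mul_comm]
    _ ≤ L * |α k| := by
        gcongr
        exact hL i _ _ (hx.subgrad k ω i)

theorem isPerturbedConsensus [MeasurableSpace Ω] {P : Measure Ω} {γ L : ℝ}
    (hx : IsProjectedSubgradientMethod f X α ψ ξ x₀ x A d)
    (hψ : ∀ i j, Measurable fun q : NetState m n × Ω' => ψ q.1 q.2 i j)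
    (hξ : ∀ k, Measurable (ξ k)) (hL : ∀ i u, ∀ s ∈ subgradients (f i) u, ‖s‖ ≤ L)
    (h_stoch : DoublyStochasticWeights P A) (h_self : SelfConfidence P γ A)
    (h_same : IdenticalConstraintSets X) :
    IsPerturbedConsensus P γ x A fun k => L * |α k| := by
  obtain ⟨Y, hY, hY', hXY⟩ := h_same
  have state_measurable : ∀ k, Measurable (x k) :=
    hx.measurable_state (fun i => (hXY i).symm ▸ hY) (fun i => (hXY i).symm ▸ hY') hψ hξ
  exact
    { measurable_state := state_measurable
      measurable_weights := fun k => hx.measurable_weights hψ hξ (state_measurable k)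
      doublyStochastic := h_stoch
      selfConfidence := h_self
      bounded_init := ⟨‖x₀‖, ae_of_all _ fun ω i => hx.init_eq ω ▸ norm_le_pi_norm x₀ i⟩
      perturbation_le := fun k => (h_stoch k).mono fun _ stoch =>
        hx.norm_state_succ_sub_mixedEstimate_le hL hY hY' hXY stoch }

end IsProjectedSubgradientMethod

theorem mainTheorem6_general {m n : ℕ} {Ω Ω' : Type*} [MeasurableSpace Ω] [MeasurableSpace Ω']
    (P : Measure Ω) [IsFiniteMeasure P]
    (f : Fin m → EuclideanSpace ℝ (Fin n) → ℝ)
    (X : Fin m → Set (EuclideanSpace ℝ (Fin n)))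
    (α : ℕ → ℝ)
    (ψ : NetState m n → Ω' → Matrix (Fin m) (Fin m) ℝ)
    (ξ : ℕ → Ω → Ω')
    (G : Digraph (Fin m)) (γ δ K C : ℝ)
    (x₀ : NetState m n)
    (x : ℕ → Ω → NetState m n)
    (A : ℕ → Ω → Matrix (Fin m) (Fin m) ℝ)
    (d : ℕ → Ω → NetState m n)
    (hγ : 0 < γ) (hδ : 0 < δ) (hK : 0 < K) (hC : 0 < C)
    (hψ : ∀ i j, Measurable fun q : NetState m n × Ω' => ψ q.1 q.2 i j)
    (hξ : ∀ k, Measurable (ξ k))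
    (hx : IsProjectedSubgradientMethod f X α ψ ξ x₀ x A d)
    (h_comm : DistanceDependentCommunication P G γ δ K C x A)
    (h_subgrad : BoundedSubgradients f)
    (h_conn : WeaklyConnectedDigraph G)
    (h_stoch : DoublyStochasticWeights P A)
    (h_self : SelfConfidence P γ A)
    (h_same : IdenticalConstraintSets X)
    (h_step : α =O[atTop] fun k : ℕ => (k : ℝ)⁻¹) (i : Fin m) :
    (∀ᵐ ω ∂P, Summable fun k : ℕ => α k * ‖x k ω i - averageEstimate (x k ω)‖) ∧
    (∀ᵐ ω ∂P, Tendsto (fun k : ℕ => ‖x k ω i - averageEstimate (x k ω)‖) atTop (𝓝 0)) := by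
  obtain ⟨L, -, hL⟩ := h_subgrad
  have consensus := hx.isPerturbedConsensus hψ hξ hL h_stoch h_self h_same
  have error_isBigO : (fun k => L * |α k|) =O[atTop] fun k : ℕ => (k : ℝ)⁻¹ :=
    h_step.norm_left.const_mul_left L
  obtain ⟨q, hq0, hq⟩ := consensus.exists_div_sqrt_le_condProb error_isBigO hδ hK hC h_comm
  have summable_disagreement :=
    consensus.ae_summable_one_div_sqrt_mul_disagreement error_isBigO hγ h_conn hq0 hq
  constructor
  · filter_upwards [summable_disagreement] with ω hω
    exact summable_mul_norm_sub_averageEstimate h_step hω i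
  · filter_upwards [summable_disagreement, consensus.ae_disagreement_succ_le] with ω hω almost_anti
    exact tendsto_norm_sub_averageEstimate
      (tendsto_disagreement_zero (u := fun k => x k ω) error_isBigO almost_anti hω) i

theorem mainTheorem6 {m n : ℕ} {Ω Ω' : Type*} [MeasurableSpace Ω] [MeasurableSpace Ω']
    (P : Measure Ω) [IsProbabilityMeasure P]
    (f : Fin m → EuclideanSpace ℝ (Fin n) → ℝ)
    (X : Fin m → Set (EuclideanSpace ℝ (Fin n)))
    (α : ℕ → ℝ)
    (ψ : NetState m n → Ω' → Matrix (Fin m) (Fin m) ℝ)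
    (ξ : ℕ → Ω → Ω')
    (G : Digraph (Fin m)) (γ δ K C : ℝ)
    (x₀ : NetState m n)
    (x : ℕ → Ω → NetState m n)
    (A : ℕ → Ω → Matrix (Fin m) (Fin m) ℝ)
    (d : ℕ → Ω → NetState m n)
    (hγ : 0 < γ) (hδ : 0 < δ) (hδ' : δ ≤ 1) (hK : 0 < K) (hC : 0 < C)
    (hα : ∀ k, 0 < α k)
    (hf : ∀ i, ConvexOn ℝ Set.univ (f i))
    (hψ : ∀ i j, Measurable fun q : NetState m n × Ω' => ψ q.1 q.2 i j)
    (hξ : ∀ k, Measurable (ξ k))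
    (hξ_indep : iIndepFun ξ P)
    (hx : IsProjectedSubgradientMethod f X α ψ ξ x₀ x A d)
    (h_comm : DistanceDependentCommunication P G γ δ K C x A)
    (h_subgrad : BoundedSubgradients f)
    (h_conn : StronglyConnectedDigraph G)
    (h_stoch : DoublyStochasticWeights P A)
    (h_self : SelfConfidence P γ A)
    (h_same : IdenticalConstraintSets X)
    (h_step : LimitingStepsizes α) :
    ∀ i : Fin m,
      (∀ᵐ ω ∂P, Summable fun k : ℕ => α k * ‖x k ω i - averageEstimate (x k ω)‖) ∧
      (∀ᵐ ω ∂P, Tendsto (fun k : ℕ => ‖x k ω i - averageEstimate (x k ω)‖) atTop (𝓝 0)) := by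
  exact mainTheorem6_general P f X α ψ ξ G γ δ K C x₀ x A d hγ hδ hK hC hψ hξ hx h_comm h_subgrad
    h_conn.weaklyConnectedDigraph h_stoch h_self h_same h_step.isBigO_inv
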